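/- Let $d \ge 5$ be an integer and let $t$ be a real number with $\frac{\sqrt{d-2}}{2} < t < \frac{\sqrt{d}}{2}$. Let $H$ be a hyperplane of $\mathbb{R}^d$ whose Euclidean distance from the center $(\frac12,\dots,\frac12)$ of the hypercube $[0,1]^d$ is $t$. Then $$\mathrm{vol}_{d-1}\bigl(H\cap[0,1]^d\bigr) \;\le\; \frac{d^{d/2}}{(d-1)!}\left(\frac{\sqrt d}{2}-t\right)^{d-1},$$ where $\mathrm{vol}_{d-1}$ is the $(d-1)$-dimensional volume. Moreover, equality holds if and only if $H$ is orthogonal to a diagonal of $[0,1]^d$, that is, to a segment joining two opposite vertices of $[0,1]^d$ (two vertices whose midpoint is the center of $[0,1]^d$). -/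

import Mathlib

open scoped MeasureTheory RealInnerProductSpace

noncomputable section

namespace Hypercube

/-- The hypercube `[0,1]^d` in Euclidean space. -/
def cube (d : ℕ) : Set (EuclideanSpace ℝ (Fin d)) :=
  {x | ∀ i, x i ∈ Set.Icc (0 : ℝ) 1}

/-- The center `(1/2, …, 1/2)` of the hypercube. -/
def center (d : ℕ) : EuclideanSpace ℝ (Fin d) :=
  WithLp.toLp 2 (fun _ => (1 / 2 : ℝ))

/-- The vertices of the hypercube: the points with all coordinates in `{0, 1}`. -/
def IsVertex {d : ℕ} (v : EuclideanSpace ℝ (Fin d)) : Prop :=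
  ∀ i, v i = 0 ∨ v i = 1

/-- `v` and `w` are the endpoints of a diagonal of the hypercube, that is, they are
opposite vertices (symmetric to each other with respect to the center). -/
def IsDiagonal {d : ℕ} (v w : EuclideanSpace ℝ (Fin d)) : Prop :=
  IsVertex v ∧ IsVertex w ∧ midpoint ℝ v w = center d

/-- A hyperplane of `ℝ^d`: a nonempty affine subspace of dimension `d - 1`. -/
def IsHyperplane {d : ℕ} (H : AffineSubspace ℝ (EuclideanSpace ℝ (Fin d))) : Prop :=
  (H : Set (EuclideanSpace ℝ (Fin d))).Nonempty ∧ Module.finrank ℝ H.direction + 1 = d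

/-- `H` is orthogonal to a diagonal of the hypercube. -/
def IsOrthogonalToDiagonal {d : ℕ} (H : AffineSubspace ℝ (EuclideanSpace ℝ (Fin d))) : Prop :=
  ∃ v w : EuclideanSpace ℝ (Fin d), IsDiagonal v w ∧ H.direction ⟂ line[ℝ, v, w].direction

/-- The `(d-1)`-dimensional volume of the section `H ∩ [0,1]^d`, that is, its
`(d-1)`-dimensional Hausdorff measure, normalized so as to agree with Lebesgue measure on
`ℝ^(d-1)`. -/
def sectionVolume {d : ℕ} (H : AffineSubspace ℝ (EuclideanSpace ℝ (Fin d))) : ENNReal :=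
  μHE[d - 1] ((H : Set (EuclideanSpace ℝ (Fin d))) ∩ cube d)

end Hypercube

end

/-!
# Shallow hyperplane sections of the hypercube

Scale the normal vector `u` of the hyperplane to norm `√d` and let it point from the hyperplane to
the center. Reflections of the cube make all coordinates of `u` nonnegative, and the hyperplane is
then `∑ i, u i * x i = b` with `b = (∑ i, u i) / 2 - √d * t`. Put `T = √d * (√d / 2 - t)`, the value
of `b` for `u = (1, …, 1)`. As `∑ i, u i ^ 2 = d`, one has `T = b + δ` with
`4 * δ = ∑ i, (1 - u i) ^ 2`, and the upper bound for the volume is `√d * T ^ (d - 1) / (d - 1)!`.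
Since `d ≥ 5`, the lower bound on `t` gives `T ≤ 1409 / 2500` (`sqrt_mul_sub_le`).

The centers of the two-dimensional faces are at distance `√(d - 2) / 2 < t` from the center, so that
`2 * b < u i + u j` for `i ≠ j` (`two_mul_lt_add`): if the section is nonempty, the hyperplane cuts
off the vertex `0` and at most one of its neighbours. Projecting along a coordinate axis
(`euclideanHausdorffMeasure_hyperplane_inter`) leaves two cases.

* If `0 < u i` and `b ≤ u i` for all `i`, the section is a simplex of volume
  `√d * b ^ (d - 1) / ((d - 1)! * ∏ i, u i)` (`section_eq_of_forall_le`), and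
  `b ^ (d - 1) < T ^ (d - 1) * ∏ i, u i` unless `u = (1, …, 1)` (`pow_lt_mul_prod`).
* If `u j ≤ b` for some `j`, then `b < u i` for `i ≠ j`, and the volume is at most
  `√d * ((b ^ (d - 1) - (b - u j) ^ (d - 1)) / u j) / ((d - 1)! * ∏ i ≠ j, u i)`
  (`section_le_prism`; for `u j = 0` the quotient is read as `(d - 1) * b ^ (d - 2)`), which is
  always smaller than the bound (`prismSum_lt_mul_prod`).

For both inequalities the product is estimated coordinatewise by
`-log x ≤ (1 - x) + κ * (1 - x) ^ 2` for `x ≥ b`, where `κ` depends on `b` only. The sums of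
`1 - u i` and `(1 - u i) ^ 2` are `2 * δ` and `4 * δ`, so that only the numbers `b`, `δ` and, in the
second case, `u j` are left. In the second case the estimate is applied to the coordinates other
than `u j`, and the remaining deficiency is `ζ = δ - (1 - u j) ^ 2 / 4`. The exponent `d - 1`
reduces to `4`, since `b ≤ T` and, in the second case, by `prismSum_le`.
-/

/-! ### Elementary bounds for the logarithm -/

namespace Hypercube

open MeasureTheory

/-- A quadratic bound for `-log` on `[s ^ 2, ∞)`, exact to first order at `1`. On `[s ^ 2, 1]` it
is the inequality `log y ≤ (y - y⁻¹) / 2` for `y = 1 / √u`. -/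
lemma neg_log_le_of_sq_le {s u : ℝ} (hs : 0 < s) (hs1 : s ≤ 1) (hu : s ^ 2 ≤ u) :
    -Real.log u ≤ (1 - u) + 1 / (s + s ^ 2) * (1 - u) ^ 2 := by
  rcases le_total u 1 with h1 | h1
  · obtain ⟨r, hr, rfl⟩ : ∃ r : ℝ, 0 < r ∧ u = r ^ 2 :=
      ⟨√u, Real.sqrt_pos.2 (by nlinarith [pow_pos hs 2]),
        (Real.sq_sqrt (by nlinarith [pow_pos hs 2])).symm⟩
    have hsr : s ≤ r := by nlinarith
    have hr1 : r ≤ 1 := by nlinarith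
    have hlog : -Real.log r ≤ (r⁻¹ - r) / 2 := by
      have := Real.self_le_sinh_iff.2 (Real.log_nonneg (one_le_inv_iff₀.2 ⟨hr, hr1⟩))
      rwa [Real.sinh_log (inv_pos.2 hr), Real.log_inv, inv_inv] at this
    have hid : r⁻¹ - r = (1 - r ^ 2) + 1 / (r + r ^ 2) * (1 - r ^ 2) ^ 2 := by
      field_simp
      ring
    have hmono : 1 / (r + r ^ 2) * (1 - r ^ 2) ^ 2 ≤ 1 / (s + s ^ 2) * (1 - r ^ 2) ^ 2 := by
      gcongr
    rw [Real.log_pow]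
    push_cast
    linarith
  · have hlog := Real.le_log_one_add_of_nonneg (x := u - 1) (by linarith)
    rw [add_sub_cancel] at hlog
    have h2 : (u - 1) - 1 / 2 * (u - 1) ^ 2 ≤ 2 * (u - 1) / (u - 1 + 2) := by
      rw [le_div_iff₀ (by linarith)]
      nlinarith [pow_nonneg (sub_nonneg.2 h1) 3]
    have h3 : 1 / 2 * (1 - u) ^ 2 ≤ 1 / (s + s ^ 2) * (1 - u) ^ 2 := by
      gcongr
      nlinarith
    nlinarith

/-- Close to the origin the constant of `neg_log_le_of_sq_le` is too large; there the coefficient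
`-log b` does as well on `[b, ∞)`. -/
lemma neg_log_le_of_le {b u : ℝ} (hb : 0 < b) (hb1 : b ≤ 1 / 10) (hL : 23 / 10 ≤ -Real.log b)
    (hu : b ≤ u) : -Real.log u ≤ (1 - u) + -Real.log b * (1 - u) ^ 2 := by
  set L := -Real.log b
  have hLu : -Real.log u ≤ L := neg_le_neg (Real.log_le_log hb hu)
  have hu0 : 0 < u := hb.trans_le hu
  -- The previous bound suffices as soon as its constant `1 / (s + s ^ 2)` is at most `L`.
  have key : ∀ s : ℝ, 0 < s → s ≤ 1 → s ^ 2 ≤ u → 1 / (s + s ^ 2) ≤ L →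
      -Real.log u ≤ (1 - u) + L * (1 - u) ^ 2 := fun s hs hs1 hsu hsL =>
    (neg_log_le_of_sq_le hs hs1 hsu).trans (by gcongr)
  rcases le_total 1 u with h1 | h1
  · exact key 1 one_pos le_rfl (by linarith) (by norm_num; linarith)
  obtain ⟨r, hr, rfl⟩ : ∃ r : ℝ, 0 < r ∧ u = r ^ 2 :=
    ⟨√u, Real.sqrt_pos.2 hu0, (Real.sq_sqrt hu0.le).symm⟩
  have hr1 : r ≤ 1 := by nlinarith
  rcases le_total 1 (L * (r + r ^ 2)) with h | h
  · exact key r hr hr1 le_rfl (by rw [div_le_iff₀ (by positivity)]; exact h)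
  · have hr3 : r ≤ 2 / 5 := by nlinarith [mul_pos hr hr]
    have h2 : L * r ^ 2 * (1 + r) ≤ r := by nlinarith
    have h3 : 2 * (L * r ^ 2) ≤ 1 - r ^ 2 := by
      by_contra hc
      push Not at hc
      nlinarith [mul_pos hr hr, mul_pos (mul_pos hr hr) hr]
    nlinarith [pow_pos hr 4, pow_pos hr 2]

lemma le_neg_log_of_le_tenth {b : ℝ} (hb : 0 < b) (hb1 : b ≤ 1 / 10) : 23 / 10 ≤ -Real.log b := by
  have h : (23 / 10 : ℝ) ≤ Real.log 10 := by
    rw [Real.le_log_iff_exp_le (by norm_num)]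
    have h1 : Real.exp (23 / 10) = Real.exp 1 ^ 2 * Real.exp (3 / 10) := by
      rw [← Real.exp_nat_mul, ← Real.exp_add]; norm_num
    have h2 := Real.exp_one_lt_d9
    have h3 := Real.exp_bound' (x := 3 / 10) (by norm_num) (by norm_num) (n := 5) (by norm_num)
    norm_num [Finset.sum_range_succ, Nat.factorial] at h3
    rw [h1]
    nlinarith [Real.exp_pos 1, Real.exp_pos (3 / 10)]
  have := Real.log_le_log hb hb1
  rw [one_div, Real.log_inv] at this
  linarith

/-- The number `1409 / 2500` is an upper bound for `T` in all dimensions `d ≥ 5`; it exceeds the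
supremum `(5 - √15) / 2` for `d = 5` by less than `10⁻³`. -/
lemma neg_le_log_tau : -(29 / 50 : ℝ) ≤ Real.log (1409 / 2500) := by
  rw [Real.le_log_iff_exp_le (by norm_num), Real.exp_neg,
    inv_le_comm₀ (Real.exp_pos _) (by norm_num)]
  have h := Real.sum_le_exp_of_nonneg (x := 29 / 50) (by norm_num) 5
  norm_num [Finset.sum_range_succ, Nat.factorial] at h
  linarith

/-- The chord of the concave function `log` between `p` and `q`. -/
lemma chord_le_log {p q x : ℝ} (hp : 0 < p) (hpq : p < q) (hx : p ≤ x) (hxq : x ≤ q) :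
    (q - x) * Real.log p + (x - p) * Real.log q ≤ (q - p) * Real.log x := by
  have h := strictConcaveOn_log_Ioi.concaveOn.2 (show p ∈ Set.Ioi (0 : ℝ) from hp)
    (show q ∈ Set.Ioi (0 : ℝ) from hp.trans hpq)
    (show 0 ≤ (q - x) / (q - p) from div_nonneg (by linarith) (by linarith))
    (show 0 ≤ (x - p) / (q - p) from div_nonneg (by linarith) (by linarith))
    (by rw [← add_div, div_eq_one_iff_eq (by linarith)]; ring)
  have hx' : (q - x) / (q - p) * p + (x - p) / (q - p) * q = x := by
    have : q - p ≠ 0 := by linarith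
    field_simp
    ring
  simp only [smul_eq_mul] at h
  rw [hx'] at h
  have := mul_le_mul_of_nonneg_left h (show 0 ≤ q - p by linarith)
  have e : (q - p) * ((q - x) / (q - p) * Real.log p + (x - p) / (q - p) * Real.log q)
      = (q - x) * Real.log p + (x - p) * Real.log q := by
    have : q - p ≠ 0 := by linarith
    field_simp
  linarith

/-! ### The two inequalities in dimension five -/

/-- The inequality in the deficiency `δ` behind the case of a single vertex. For `b ≥ 1 / 10` it
follows from `log (1 + y) ≥ 2 * y / (y + 2)`; for smaller `b` that bound is too weak, and the chord
of the logarithm between `b` and `1409 / 2500` is used instead. -/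
lemma exists_quadratic_bound_simplex {b δ : ℝ} (hb : 0 < b) (hδ : 0 < δ)
    (hτ : b + δ ≤ 1409 / 2500) :
    ∃ κ : ℝ, 0 ≤ κ ∧ (∀ u, b ≤ u → -Real.log u ≤ (1 - u) + κ * (1 - u) ^ 2) ∧
      (2 + 4 * κ) * δ < 4 * (Real.log (b + δ) - Real.log b) := by
  rcases le_total b (1 / 10) with h | h
  · have hL := le_neg_log_of_le_tenth hb h
    refine ⟨-Real.log b, by linarith, fun u hu => neg_log_le_of_le hb h hL hu, ?_⟩
    have hc := chord_le_log hb (show b < 1409 / 2500 by linarith) (show b ≤ b + δ by linarith) hτ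
    have hτ' := neg_le_log_tau
    have h1 : δ * (Real.log (1409 / 2500) - Real.log b) ≤
        (1409 / 2500 - b) * (Real.log (b + δ) - Real.log b) := by linarith
    have h2 : (2 + 4 * -Real.log b) * (1409 / 2500 - b) <
        4 * (Real.log (1409 / 2500) - Real.log b) := by nlinarith
    have h3 : (1409 / 2500 - b) * ((2 + 4 * -Real.log b) * δ) <
        (1409 / 2500 - b) * (4 * (Real.log (b + δ) - Real.log b)) := by nlinarith
    exact lt_of_mul_lt_mul_left h3 (by linarith)
  · obtain ⟨s, hs, rfl⟩ : ∃ s : ℝ, 0 < s ∧ b = s ^ 2 :=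
      ⟨√b, Real.sqrt_pos.2 hb, (Real.sq_sqrt hb.le).symm⟩
    have hs1 : s ≤ 76 / 100 := by nlinarith
    have hs2 : 316 / 1000 ≤ s := by nlinarith
    refine ⟨1 / (s + s ^ 2), by positivity,
      fun u hu => neg_log_le_of_sq_le hs (by linarith) hu, ?_⟩
    have hl := Real.le_log_one_add_of_nonneg (x := δ / s ^ 2) (by positivity)
    rw [show 1 + δ / s ^ 2 = (s ^ 2 + δ) / s ^ 2 by field_simp,
      Real.log_div (by positivity) (by positivity)] at hl
    refine lt_of_lt_of_le ?_ (mul_le_mul_of_nonneg_left hl (by norm_num))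
    have e1 : 4 * (2 * (δ / s ^ 2) / (δ / s ^ 2 + 2)) = δ * (8 / (δ + 2 * s ^ 2)) := by
      field_simp
      ring
    have e2 : (2 + 4 * (1 / (s + s ^ 2))) * δ = δ * ((2 * (s + s ^ 2) + 4) / (s + s ^ 2)) := by
      field_simp
    rw [e1, e2]
    refine mul_lt_mul_of_pos_left ?_ hδ
    rw [div_lt_div_iff₀ (by positivity) (by positivity)]
    have h4 : (2 * (s + s ^ 2) + 4) * (δ + 2 * s ^ 2) ≤
        (2 * (s + s ^ 2) + 4) * (1409 / 2500 + s ^ 2) :=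
      mul_le_mul_of_nonneg_left (by linarith) (by positivity)
    have h5 : (2 * (s + s ^ 2) + 4) * (1409 / 2500 + s ^ 2) < 8 * (s + s ^ 2) := by
      nlinarith [mul_nonneg (sub_nonneg.2 hs1) (sub_nonneg.2 hs2),
        mul_nonneg (mul_nonneg (sub_nonneg.2 hs1) (sub_nonneg.2 hs2)) hs.le,
        mul_nonneg (mul_nonneg (sub_nonneg.2 hs1) (sub_nonneg.2 hs2)) (sq_nonneg s)]
    linarith

/-- With `b = m + u / 2` and `v = u ^ 2`, the numerator is `(b ^ 4 - (b - u) ^ 4) / u` and the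
denominator is `(b + (1 - u) ^ 2 / 4) ^ 4`. By monotonicity only the largest admissible `b` has to
be considered. -/
lemma prism_ratio_mono {v m M : ℝ} (hv : 0 ≤ v) (hm : 0 < m) (hvm : v ≤ 4 * m ^ 2) (hmM : m ≤ M)
    (hM : M < 1 / 3) :
    (4 * m ^ 3 + m * v) / (m + (1 + v) / 4) ^ 4 ≤ (4 * M ^ 3 + M * v) / (M + (1 + v) / 4) ^ 4 := by
  have hmono : MonotoneOn (fun x : ℝ => (4 * x ^ 3 + x * v) / (x + (1 + v) / 4) ^ 4)
      (Set.Icc m M) := by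
    refine monotoneOn_of_hasDerivWithinAt_nonneg (f' := fun x =>
      ((4 * (3 * x ^ 2) + v) * (x + (1 + v) / 4) ^ 4 -
        (4 * x ^ 3 + x * v) * (4 * (x + (1 + v) / 4) ^ 3)) / ((x + (1 + v) / 4) ^ 4) ^ 2)
      (convex_Icc _ _) ?_ ?_ ?_
    · refine ContinuousOn.div (by fun_prop) (by fun_prop) fun x hx => ?_
      have : 0 < x := hm.trans_le hx.1
      positivity
    · intro x hx
      rw [interior_Icc] at hx
      have hx0 : 0 < x := hm.trans hx.1
      refine HasDerivAt.hasDerivWithinAt (HasDerivAt.div ?_ ?_ (by positivity))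
      · have := ((hasDerivAt_pow 3 x).const_mul 4).fun_add ((hasDerivAt_id x).mul_const v)
        simpa using this
      · have := ((hasDerivAt_id x).add_const ((1 + v) / 4)).fun_pow 4
        simpa using this
    · intro x hx
      rw [interior_Icc] at hx
      have hx0 : 0 < x := hm.trans hx.1
      have hvx : v ≤ 4 * x ^ 2 := hvm.trans (by nlinarith [hx.1])
      refine div_nonneg ?_ (by positivity)
      have e : (4 * (3 * x ^ 2) + v) * (x + (1 + v) / 4) ^ 4 -
          (4 * x ^ 3 + x * v) * (4 * (x + (1 + v) / 4) ^ 3) =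
          (x + (1 + v) / 4) ^ 3 *
            (x ^ 2 * (3 - 4 * x) + v * (3 * x ^ 2 - 3 * x + 1 / 4) + v ^ 2 / 4) := by ring
      rw [e]
      refine mul_nonneg (by positivity) ?_
      have hxM : x < 1 / 3 := hx.2.trans hM
      rcases le_total 0 (3 * x ^ 2 - 3 * x + 1 / 4) with hq | hq
      · have : 0 ≤ x ^ 2 * (3 - 4 * x) := mul_nonneg (sq_nonneg x) (by linarith)
        positivity
      · have h1 := mul_le_mul_of_nonpos_right hvx hq
        have h2 : 0 ≤ x ^ 2 * ((1 - x) * (1 - 3 * x)) :=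
          mul_nonneg (sq_nonneg x) (mul_nonneg (by linarith) (by linarith))
        nlinarith [sq_nonneg v]
  exact hmono ⟨le_rfl, hmM⟩ ⟨hmM, le_rfl⟩ hmM

/-- The case `ζ = 0` of `exists_quadratic_bound_prism`. -/
lemma prism_bound_of_minimal_deficiency {b u : ℝ} (hu : 0 ≤ u) (hub : u ≤ b) (hb : 0 < b)
    (hτ : b + (1 - u) ^ 2 / 4 ≤ 1409 / 2500) :
    Real.log (4 * b ^ 3 - 6 * b ^ 2 * u + 4 * b * u ^ 2 - u ^ 3) - (1 - u ^ 2) / 2 <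
      4 * Real.log (b + (1 - u) ^ 2 / 4) := by
  obtain ⟨m, rfl⟩ : ∃ m, b = m + u / 2 := ⟨b - u / 2, by ring⟩
  have hm : 0 < m := by linarith
  have hu1 : u ≤ 1 / 2 + 2 / 1000 := by nlinarith
  set v := u ^ 2 with hv
  have hv0 : 0 ≤ v := sq_nonneg u
  have hv1 : v ≤ 2521 / 10000 := by nlinarith
  have e1 : 4 * (m + u / 2) ^ 3 - 6 * (m + u / 2) ^ 2 * u + 4 * (m + u / 2) * v - u ^ 3 =
      4 * m ^ 3 + m * v := by rw [hv]; ring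
  have e2 : m + u / 2 + (1 - u) ^ 2 / 4 = m + (1 + v) / 4 := by rw [hv]; ring
  rw [e1, e2]
  rw [e2] at hτ
  have hG : 0 < 4 * m ^ 3 + m * v := by positivity
  have hT : 0 < m + (1 + v) / 4 := by positivity
  have hr := prism_ratio_mono hv0 hm (by nlinarith) (show m ≤ 1409 / 2500 - (1 + v) / 4 by linarith)
    (by linarith)
  rw [sub_add_cancel] at hr
  set M := 1409 / 2500 - (1 + v) / 4 with hM
  have hM1 : 4 * M ^ 3 + M * v ≤ 135 / 1000 := by
    rw [hM]
    nlinarith [mul_nonneg hv0 (sub_nonneg.2 hv1), mul_nonneg (mul_nonneg hv0 hv0) hv0]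
  have hw := Real.quadratic_le_exp_of_nonneg (x := (1 - v) / 2) (by linarith)
  have hw1 : (1441 / 1000 : ℝ) ≤ Real.exp ((1 - v) / 2) := by nlinarith
  have hr2 : (4 * m ^ 3 + m * v) / (m + (1 + v) / 4) ^ 4 < Real.exp ((1 - v) / 2) := by
    refine (hr.trans ?_).trans_lt (lt_of_lt_of_le ?_ hw1) (b := 135 / 1000 / (1409 / 2500) ^ 4)
    · gcongr
    · norm_num
  rw [div_lt_iff₀ (by positivity)] at hr2
  have := Real.log_lt_log hG hr2
  rw [Real.log_mul (by positivity) (by positivity), Real.log_exp, Real.log_pow] at this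
  push_cast at this
  linarith

/-- The inequality in the deficiency `ζ` behind the case of two vertices. For `b ≥ 1 / 10` the term
in `ζ` is absorbed by replacing `b` with `b + ζ`, which leads to the case `ζ = 0`; for smaller `b`
the numerator is at most `4 * b ^ 3` and the right-hand side at least `4 * log (1 / 4 + ζ)`. -/
lemma exists_quadratic_bound_prism {b u ζ : ℝ} (hb : 0 < b) (hu : 0 ≤ u) (hub : u ≤ b)
    (hζ : 0 ≤ ζ) (hτ : b + (1 - u) ^ 2 / 4 + ζ ≤ 1409 / 2500) :
    ∃ κ : ℝ, 0 ≤ κ ∧ (∀ x, b ≤ x → -Real.log x ≤ (1 - x) + κ * (1 - x) ^ 2) ∧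
      Real.log (4 * b ^ 3 - 6 * b ^ 2 * u + 4 * b * u ^ 2 - u ^ 3) - (1 - u ^ 2) / 2 +
        (2 + 4 * κ) * ζ < 4 * Real.log (b + (1 - u) ^ 2 / 4 + ζ) := by
  have hG : 0 < 4 * b ^ 3 - 6 * b ^ 2 * u + 4 * b * u ^ 2 - u ^ 3 := by
    have : 4 * b ^ 3 - 6 * b ^ 2 * u + 4 * b * u ^ 2 - u ^ 3 =
      b ^ 3 + b ^ 2 * (b - u) + b * (b - u) ^ 2 + (b - u) ^ 3 := by ring
    rw [this]
    have := sub_nonneg.2 hub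
    positivity
  rcases le_total b (1 / 10) with h | h
  · have hL := le_neg_log_of_le_tenth hb h
    refine ⟨-Real.log b, by linarith, fun u hu => neg_log_le_of_le hb h hL hu, ?_⟩
    have h1 : Real.log (4 * b ^ 3 - 6 * b ^ 2 * u + 4 * b * u ^ 2 - u ^ 3) ≤
        2 * Real.log 2 + 3 * Real.log b := by
      have h2 : Real.log (4 * b ^ 3) = 2 * Real.log 2 + 3 * Real.log b := by
        rw [Real.log_mul (by norm_num) (by positivity), show (4 : ℝ) = 2 ^ 2 by norm_num,
          Real.log_pow, Real.log_pow]
        norm_num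
      rw [← h2]
      refine Real.log_le_log hG ?_
      nlinarith [mul_nonneg hu (sub_nonneg.2 hub),
        mul_nonneg (mul_nonneg hu (sub_nonneg.2 hub)) hb.le,
        mul_nonneg (mul_nonneg hu hb.le) hb.le, pow_nonneg hu 3]
    have h3 : Real.log (1 / 4 + ζ) ≤ Real.log (b + (1 - u) ^ 2 / 4 + ζ) :=
      Real.log_le_log (by positivity) (by nlinarith)
    have hc := chord_le_log (p := 1 / 4) (q := 1409 / 2500) (x := 1 / 4 + ζ) (by norm_num)
      (by norm_num) (by linarith) (by nlinarith)
    have h4 : Real.log (1 / 4) = -(2 * Real.log 2) := by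
      rw [one_div, Real.log_inv, show (4 : ℝ) = 2 ^ 2 by norm_num, Real.log_pow]
      norm_num
    rw [h4] at hc
    have hζ1 : ζ ≤ 784 / 2500 := by nlinarith
    have hu2 : u ^ 2 ≤ 1 / 100 := by nlinarith
    have hl2 := Real.log_two_lt_d9
    have hτ' := neg_le_log_tau
    -- The claim is affine in `ζ` once `log (1 / 4 + ζ)` is replaced by its chord.
    have end0 : 2 * Real.log 2 + 3 * Real.log b - 99 / 200 < 4 * -(2 * Real.log 2) := by linarith
    have end1 : 2 * Real.log 2 + 3 * Real.log b - 99 / 200 + (2 + 4 * -Real.log b) * (784 / 2500) <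
        4 * Real.log (1409 / 2500) := by linarith
    nlinarith
  · obtain ⟨s, hs, rfl⟩ : ∃ s : ℝ, 0 < s ∧ b = s ^ 2 :=
      ⟨√b, Real.sqrt_pos.2 hb, (Real.sq_sqrt hb.le).symm⟩
    have hs1 : s ≤ 71 / 100 := by nlinarith
    have hs2 : 316 / 1000 ≤ s := by nlinarith
    refine ⟨1 / (s + s ^ 2), by positivity,
      fun u hu => neg_log_le_of_sq_le hs (by linarith) hu, ?_⟩
    have hmin := prism_bound_of_minimal_deficiency (b := s ^ 2 + ζ) hu (by linarith)
      (by positivity) (by linarith)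
    rw [show s ^ 2 + ζ + (1 - u) ^ 2 / 4 = s ^ 2 + (1 - u) ^ 2 / 4 + ζ by ring] at hmin
    refine lt_of_le_of_lt ?_ hmin
    -- The numerator is homogeneous of degree three, and grows at least like the cube of `b`.
    have hhom : ((s ^ 2 + ζ) / s ^ 2) ^ 3 *
        (4 * (s ^ 2) ^ 3 - 6 * (s ^ 2) ^ 2 * u + 4 * s ^ 2 * u ^ 2 - u ^ 3) ≤
        4 * (s ^ 2 + ζ) ^ 3 - 6 * (s ^ 2 + ζ) ^ 2 * u + 4 * (s ^ 2 + ζ) * u ^ 2 - u ^ 3 := by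
      obtain ⟨c, hc, hc1⟩ : ∃ c : ℝ, s ^ 2 + ζ = c * s ^ 2 ∧ 1 ≤ c :=
        ⟨(s ^ 2 + ζ) / s ^ 2, by field_simp, by rw [le_div_iff₀ (by positivity)]; linarith⟩
      rw [hc, mul_div_cancel_right₀ _ (by positivity)]
      have hx : c * (s ^ 2 - u) ≤ c * s ^ 2 - u := by nlinarith
      have hx0 : 0 ≤ c * (s ^ 2 - u) := mul_nonneg (by linarith) (by linarith)
      have hb' : 0 ≤ c * s ^ 2 := by positivity
      have i1 := mul_le_mul_of_nonneg_left hx (pow_nonneg hb' 2)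
      have i2 := mul_le_mul_of_nonneg_left (pow_le_pow_left₀ hx0 hx 2) hb'
      have i3 := pow_le_pow_left₀ hx0 hx 3
      nlinarith
    have hl1 := Real.log_le_log (by positivity) hhom
    rw [Real.log_mul (by positivity) hG.ne', Real.log_pow] at hl1
    push_cast at hl1
    have hl := Real.le_log_one_add_of_nonneg (x := ζ / s ^ 2) (by positivity)
    rw [show 1 + ζ / s ^ 2 = (s ^ 2 + ζ) / s ^ 2 by field_simp] at hl
    have hk : (2 + 4 * (1 / (s + s ^ 2))) * ζ ≤ 3 * (2 * (ζ / s ^ 2) / (ζ / s ^ 2 + 2)) := by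
      have e1 : 3 * (2 * (ζ / s ^ 2) / (ζ / s ^ 2 + 2)) = ζ * (6 / (ζ + 2 * s ^ 2)) := by
        field_simp
        ring
      have e2 : (2 + 4 * (1 / (s + s ^ 2))) * ζ = ζ * ((2 * (s + s ^ 2) + 4) / (s + s ^ 2)) := by
        field_simp
      rw [e1, e2]
      refine mul_le_mul_of_nonneg_left ?_ hζ
      rw [div_le_div_iff₀ (by positivity) (by positivity)]
      have hb4 : (1 - s ^ 2) ^ 2 ≤ (1 - u) ^ 2 := by
        have : s ^ 2 ≤ 1 := by nlinarith
        exact pow_le_pow_left₀ (by linarith) (by linarith) 2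
      have h4 : (2 * (s + s ^ 2) + 4) * (ζ + 2 * s ^ 2) ≤
          (2 * (s + s ^ 2) + 4) * (1409 / 2500 + s ^ 2 - (1 - s ^ 2) ^ 2 / 4) := by
        gcongr
        linarith
      have h5 : (2 * (s + s ^ 2) + 4) * (1409 / 2500 + s ^ 2 - (1 - s ^ 2) ^ 2 / 4) ≤
          6 * (s + s ^ 2) := by
        have := mul_nonneg (sub_nonneg.2 hs1) (sub_nonneg.2 hs2)
        nlinarith [mul_nonneg this hs.le, mul_nonneg this (sq_nonneg s),
          mul_nonneg this (pow_nonneg hs.le 3), mul_nonneg this (pow_nonneg hs.le 4)]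
      linarith
    linarith

/-! ### The two inequalities in arbitrary dimension -/

/-- The quotient `(b ^ n - (b - u) ^ n) / u`, written as a geometric sum, with its value
`n * b ^ (n - 1)` at `u = 0`. -/
def prismSum (b u : ℝ) (n : ℕ) : ℝ :=
  ∑ i ∈ Finset.range n, (b - u) ^ i * b ^ (n - 1 - i)

lemma prismSum_succ (b u : ℝ) (n : ℕ) :
    prismSum b u (n + 1) = (b - u) ^ n + b * prismSum b u n := by
  simpa [prismSum] using geom_sum₂_succ_eq (b - u) b (n := n)

lemma prismSum_four (b u : ℝ) :
    prismSum b u 4 = 4 * b ^ 3 - 6 * b ^ 2 * u + 4 * b * u ^ 2 - u ^ 3 := by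
  simp only [prismSum, Finset.sum_range_succ, Finset.sum_range_zero]
  norm_num
  ring

lemma four_mul_pow_le_prismSum {b u : ℝ} (hu : 0 ≤ u) (hub : u ≤ b) {n : ℕ} (hn : 4 ≤ n) :
    4 * (b - u) ^ (n - 1) ≤ prismSum b u n := by
  have hx : 0 ≤ b - u := by linarith
  have h : ∀ i ∈ Finset.range n, (b - u) ^ (n - 1) ≤ (b - u) ^ i * b ^ (n - 1 - i) := by
    intro i hi
    rw [Finset.mem_range] at hi
    calc (b - u) ^ (n - 1) = (b - u) ^ i * (b - u) ^ (n - 1 - i) := by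
          rw [← pow_add]; congr 1; omega
      _ ≤ _ := by gcongr; linarith
  have h2 := Finset.card_nsmul_le_sum _ _ _ h
  rw [Finset.card_range, nsmul_eq_mul] at h2
  have : (4 : ℝ) ≤ n := by exact_mod_cast hn
  exact (mul_le_mul_of_nonneg_right this (pow_nonneg hx _)).trans h2

/-- The quotient `prismSum b u n / T ^ n` is nonincreasing in `n`, which reduces the case of two
vertices to dimension five. -/
lemma prismSum_le {b u T : ℝ} (hu : 0 ≤ u) (hub : u ≤ b) (hT : b + (1 - u) ^ 2 / 4 ≤ T)
    (hT1 : T ≤ 3 / 4) {n : ℕ} (hn : 4 ≤ n) :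
    prismSum b u n ≤ prismSum b u 4 * T ^ (n - 4) := by
  induction n, hn using Nat.le_induction with
  | base => simp
  | succ n hn ih =>
    have hT0 : 0 ≤ T := by nlinarith
    have h4 := four_mul_pow_le_prismSum hu hub hn
    have hstep : (b - u) ^ n ≤ (T - b) * prismSum b u n := by
      calc (b - u) ^ n = (b - u) / 4 * (4 * (b - u) ^ (n - 1)) := by
            obtain ⟨k, rfl⟩ : ∃ k, n = k + 1 := ⟨n - 1, by omega⟩
            simp only [Nat.add_sub_cancel]
            ring
        _ ≤ (T - b) * prismSum b u n := by
            refine mul_le_mul (by nlinarith [sq_nonneg (u - 1 / 2), sq_nonneg (1 - u)]) h4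
              (mul_nonneg (by norm_num) (pow_nonneg (by linarith) _)) ?_
            nlinarith [sq_nonneg (1 - u)]
    rw [prismSum_succ, show n + 1 - 4 = (n - 4) + 1 by omega, pow_succ]
    nlinarith [mul_le_mul_of_nonneg_left ih hT0]

section

variable {ι : Type*} [Fintype ι]

lemma sum_one_sub_sq {u : ι → ℝ} (hu2 : ∑ i, u i ^ 2 = Fintype.card ι) :
    ∑ i, (1 - u i) ^ 2 = 4 * ((Fintype.card ι - ∑ i, u i) / 2) := by
  have : ∑ i, (1 - u i) ^ 2 = ∑ i, (1 - 2 * u i + u i ^ 2) :=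
    Finset.sum_congr rfl fun i _ => by ring
  rw [this, Finset.sum_add_distrib, Finset.sum_sub_distrib, hu2, ← Finset.mul_sum]
  simp
  ring

lemma sum_one_sub (u : ι → ℝ) :
    ∑ i, (1 - u i) = 2 * ((Fintype.card ι - ∑ i, u i) / 2) := by
  rw [Finset.sum_sub_distrib]
  simp
  ring

/-- The inequality for a hyperplane that cuts off a single vertex. -/
lemma pow_lt_mul_prod {u : ι → ℝ} {b T : ℝ} {n : ℕ} (hn : 4 ≤ n)
    (hu2 : ∑ i, u i ^ 2 = Fintype.card ι) (hT : T = b + (Fintype.card ι - ∑ i, u i) / 2)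
    (hτ : T ≤ 1409 / 2500) (hb : 0 ≤ b) (hbu : ∀ i, b ≤ u i) (hu : ∀ i, 0 < u i)
    (hne : ∃ i, u i ≠ 1) :
    b ^ n < T ^ n * ∏ i, u i := by
  set δ := ((Fintype.card ι : ℝ) - ∑ i, u i) / 2 with hδ_def
  have hsq := sum_one_sub_sq hu2
  have hδ : 0 < δ := by
    obtain ⟨i, hi⟩ := hne
    have : 0 < ∑ i, (1 - u i) ^ 2 :=
      Finset.sum_pos' (fun _ _ => sq_nonneg _) ⟨i, Finset.mem_univ i, by
        have : 1 - u i ≠ 0 := sub_ne_zero.2 hi.symm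
        positivity⟩
    linarith
  have hT0 : 0 < T := by linarith
  have hprod : 0 < ∏ i, u i := Finset.prod_pos fun i _ => hu i
  rcases hb.eq_or_lt with rfl | hb
  · rw [zero_pow (by omega)]
    positivity
  obtain ⟨κ, -, hκ, hlt⟩ := exists_quadratic_bound_simplex hb hδ (by linarith)
  have hsum : -∑ i, Real.log (u i) ≤ (2 + 4 * κ) * δ := by
    rw [← Finset.sum_neg_distrib]
    refine (Finset.sum_le_sum fun i _ => hκ (u i) (hbu i)).trans_eq ?_
    rw [Finset.sum_add_distrib, ← Finset.mul_sum, hsq, sum_one_sub]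
    ring
  have hn' : (4 : ℝ) ≤ n := by exact_mod_cast hn
  have hmono : Real.log b ≤ Real.log T := Real.log_le_log hb (by linarith)
  rw [← Real.log_lt_log_iff (by positivity) (by positivity),
    Real.log_mul (by positivity) (by positivity), Real.log_pow, Real.log_pow,
    Real.log_prod fun i _ => (hu i).ne']
  rw [← hT] at hlt
  nlinarith

/-- The inequality for a hyperplane that cuts off the two vertices of an edge in direction `j`. -/
lemma prismSum_lt_mul_prod [DecidableEq ι] {u : ι → ℝ} {b T : ℝ} {n : ℕ} (hn : 4 ≤ n)
    (hu2 : ∑ i, u i ^ 2 = Fintype.card ι) (hT : T = b + (Fintype.card ι - ∑ i, u i) / 2)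
    (hT0 : 0 < T) (hτ : T ≤ 1409 / 2500) (j : ι) (huj : 0 ≤ u j) (hujb : u j ≤ b)
    (hbu : ∀ i ≠ j, b ≤ u i) (hu : ∀ i ≠ j, 0 < u i) :
    prismSum b (u j) n < T ^ n * ∏ i ∈ Finset.univ.erase j, u i := by
  have hsq := sum_one_sub_sq hu2
  have hsum1 := sum_one_sub u
  set δ := ((Fintype.card ι : ℝ) - ∑ i, u i) / 2 with hδ_def
  rw [← Finset.add_sum_erase _ _ (Finset.mem_univ j)] at hsq hsum1
  have hζ : 0 ≤ δ - (1 - u j) ^ 2 / 4 := by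
    have : 0 ≤ ∑ i ∈ Finset.univ.erase j, (1 - u i) ^ 2 :=
      Finset.sum_nonneg fun _ _ => sq_nonneg _
    linarith
  have hprod : 0 < ∏ i ∈ Finset.univ.erase j, u i :=
    Finset.prod_pos fun i hi => hu i (Finset.ne_of_mem_erase hi)
  have hb0 : 0 ≤ b := huj.trans hujb
  have hred := prismSum_le huj hujb (T := T) (by linarith) (by linarith) hn
  suffices h : prismSum b (u j) 4 < T ^ 4 * ∏ i ∈ Finset.univ.erase j, u i by
    have h1 := mul_lt_mul_of_pos_right h (pow_pos hT0 (n - 4))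
    have h2 : T ^ n = T ^ 4 * T ^ (n - 4) := by rw [← pow_add]; congr 1; omega
    rw [h2]
    linarith
  rcases hb0.eq_or_lt with rfl | hb
  · have : u j = 0 := le_antisymm hujb huj
    rw [prismSum_four, this]
    norm_num
    positivity
  obtain ⟨κ, -, hκ, hlt⟩ := exists_quadratic_bound_prism hb huj hujb hζ (by linarith)
  have hsum : -∑ i ∈ Finset.univ.erase j, Real.log (u i) ≤
      -(1 - u j ^ 2) / 2 + (2 + 4 * κ) * (δ - (1 - u j) ^ 2 / 4) := by
    rw [← Finset.sum_neg_distrib]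
    refine (Finset.sum_le_sum fun i hi => hκ (u i) (hbu i (Finset.ne_of_mem_erase hi))).trans_eq ?_
    rw [Finset.sum_add_distrib, ← Finset.mul_sum]
    have e1 : ∑ i ∈ Finset.univ.erase j, (1 - u i) ^ 2 = 4 * δ - (1 - u j) ^ 2 := by linarith
    have e2 : ∑ i ∈ Finset.univ.erase j, (1 - u i) = 2 * δ - (1 - u j) := by linarith
    rw [e1, e2]
    ring
  have hG : 0 < prismSum b (u j) 4 := by
    rw [prismSum_four]
    have : 4 * b ^ 3 - 6 * b ^ 2 * u j + 4 * b * u j ^ 2 - u j ^ 3 =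
      b ^ 3 + b ^ 2 * (b - u j) + b * (b - u j) ^ 2 + (b - u j) ^ 3 := by ring
    rw [this]
    have := sub_nonneg.2 hujb
    positivity
  rw [← Real.log_lt_log_iff hG (by positivity),
    Real.log_mul (by positivity) (by positivity), Real.log_pow,
    Real.log_prod fun i hi => (hu i (Finset.ne_of_mem_erase hi)).ne', prismSum_four]
  rw [show b + (1 - u j) ^ 2 / 4 + (δ - (1 - u j) ^ 2 / 4) = T by rw [hT]; ring] at hlt
  push_cast
  linarith

end

/-! ### The volume of a hyperplane section as the volume of a coordinate projection -/

lemma abs_det_submatrix_succAbove {n : ℕ} (M : Matrix (Fin (n + 1)) (Fin (n + 1)) ℝ)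
    (hM : M * M.transpose = 1) (j : Fin (n + 1)) :
    |(M.submatrix j.succAbove j.succAbove).det| = |M j j| := by
  have hdet : |M.det| = 1 := by
    have h := congrArg Matrix.det hM
    rw [Matrix.det_mul, Matrix.det_transpose, Matrix.det_one] at h
    rcases mul_self_eq_one_iff.1 h with h | h <;> simp [h]
  have hadj : M.adjugate = M.det • M.transpose := by
    calc M.adjugate = M.adjugate * (M * M.transpose) := by rw [hM, mul_one]
      _ = M.det • M.transpose := by
        rw [← mul_assoc, Matrix.adjugate_mul, Matrix.smul_mul, one_mul]
  have h := congrFun (congrFun hadj j) j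
  rw [Matrix.adjugate_fin_succ_eq_det_submatrix, ← two_mul, pow_mul] at h
  simp only [even_two, Even.neg_pow, one_pow, one_mul, Matrix.smul_apply, Matrix.transpose_apply,
    smul_eq_mul] at h
  rw [h, abs_mul, hdet, one_mul]

/-- The part of a hyperplane with unit normal `a` that lies in `C`, seen as a graph over the
coordinate hyperplane `x j = 0`. In an orthonormal basis whose `j`-th vector is `a`, the projection
along the `j`-th axis has as its matrix a minor of an orthogonal matrix, whose determinant is
`± a j`. -/
lemma euclideanHausdorffMeasure_hyperplane_inter {n : ℕ} (a : Fin (n + 1) → ℝ)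
    (ha : ∑ i, a i ^ 2 = 1) (b : ℝ) (j : Fin (n + 1)) (hj : a j ≠ 0)
    (C : Set (EuclideanSpace ℝ (Fin (n + 1)))) :
    μHE[n] ({x : EuclideanSpace ℝ (Fin (n + 1)) | ∑ i, a i * x i = b} ∩ C) =
      ENNReal.ofReal |a j|⁻¹ * volume {y : Fin n → ℝ |
        WithLp.toLp 2 (j.insertNth (α := fun _ => ℝ)
          ((b - ∑ k, a (j.succAbove k) * y k) / a j) y) ∈ C} := by
  obtain ⟨e, he⟩ : ∃ e : OrthonormalBasis (Fin (n + 1)) ℝ (EuclideanSpace ℝ (Fin (n + 1))),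
      e j = WithLp.toLp 2 a := by
    obtain ⟨e, he⟩ := Orthonormal.exists_orthonormalBasis_extension_of_card_eq (𝕜 := ℝ)
      (E := EuclideanSpace ℝ (Fin (n + 1))) (ι := Fin (n + 1)) (by simp)
      (v := fun _ => WithLp.toLp 2 a) (s := {j}) (by
        refine ⟨fun i => ?_, fun i k hik => absurd (Subsingleton.elim i k) hik⟩
        simp [EuclideanSpace.norm_eq, ha])
    exact ⟨e, he j rfl⟩
  -- The isometric parametrization of the hyperplane.
  let ι : EuclideanSpace ℝ (Fin n) → EuclideanSpace ℝ (Fin (n + 1)) :=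
    fun y => WithLp.toLp 2 (j.insertNth (α := fun _ => ℝ) b y)
  have hι : Isometry ι := by
    refine Isometry.of_dist_eq fun x y => ?_
    simp [ι, EuclideanSpace.dist_eq, Fin.sum_univ_succAbove _ j]
  let φ : EuclideanSpace ℝ (Fin n) → EuclideanSpace ℝ (Fin (n + 1)) := fun y => e.repr.symm (ι y)
  have hφ : Isometry φ := e.repr.symm.isometry.comp hι
  have hcoord : ∀ x, e.repr x j = ∑ i, a i * x i := by
    intro x
    rw [e.repr_apply_apply, he, EuclideanSpace.inner_eq_star_dotProduct]
    simp [dotProduct, mul_comm]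
  have hrange : Set.range φ = {x | ∑ i, a i * x i = b} := by
    ext x
    simp only [Set.mem_range, Set.mem_ofPred_eq, ← hcoord]
    constructor
    · rintro ⟨y, rfl⟩
      simp [φ, ι]
    · intro hx
      refine ⟨WithLp.toLp 2 fun k => e.repr x (j.succAbove k), ?_⟩
      rw [LinearIsometryEquiv.symm_apply_eq]
      ext i
      refine Fin.succAboveCases j ?_ (fun k => ?_) i
      · simp [ι, hx]
      · simp [ι]
  let M : Matrix (Fin (n + 1)) (Fin (n + 1)) ℝ := Matrix.of fun k l => e k l
  have hM : M * M.transpose = 1 := by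
    ext k l
    have := orthonormal_iff_ite.1 e.orthonormal k l
    rw [EuclideanSpace.inner_eq_star_dotProduct] at this
    simp only [Matrix.mul_apply, Matrix.transpose_apply, M, Matrix.of_apply, Matrix.one_apply]
    rw [← this]
    simp [dotProduct, mul_comm]
  have hMj : M j j = a j := by simp [M, he]
  let N := (M.submatrix j.succAbove j.succAbove).transpose
  have hN : |N.det| = |a j| := by
    rw [Matrix.det_transpose, abs_det_submatrix_succAbove M hM, hMj]
  have hN0 : LinearMap.det (Matrix.toLin' N) ≠ 0 := by
    rw [LinearMap.det_toLin', ← abs_ne_zero, hN]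
    exact abs_ne_zero.2 hj
  have hφ_apply : ∀ y k, φ y (j.succAbove k) =
      Matrix.toLin' N (WithLp.ofLp y) k + b * a (j.succAbove k) := by
    intro y k
    have : φ y = ∑ i, ι y i • e i := (e.sum_repr_symm (ι y)).symm
    rw [this, Fin.sum_univ_succAbove _ j, he]
    simp [ι, N, M, Matrix.mulVec, dotProduct, mul_comm, add_comm]
  set S : Set (Fin n → ℝ) := {y | WithLp.toLp 2 (j.insertNth (α := fun _ => ℝ)
          ((b - ∑ k, a (j.succAbove k) * y k) / a j) y) ∈ C} with hS
  have hmem : ∀ x : EuclideanSpace ℝ (Fin (n + 1)), ∑ i, a i * x i = b →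
      (x ∈ C ↔ (fun k => x (j.succAbove k)) ∈ S) := by
    intro x hx
    rw [hS, Set.mem_ofPred_eq]
    have : x = WithLp.toLp 2 (j.insertNth (α := fun _ => ℝ)
        ((b - ∑ k, a (j.succAbove k) * x (j.succAbove k)) / a j)
        (fun k => x (j.succAbove k))) := by
      ext i
      refine Fin.succAboveCases j ?_ (fun k => ?_) i
      · rw [Fin.sum_univ_succAbove _ j] at hx
        simp only [Fin.insertNth_apply_same]
        rw [eq_div_iff hj, ← hx]
        ring
      · simp
    rw [← this]
  have hpre : φ ⁻¹' C = (MeasurableEquiv.toLp 2 (Fin n → ℝ)).symm ⁻¹'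
      (Matrix.toLin' N ⁻¹' ((fun z => z + fun k => b * a (j.succAbove k)) ⁻¹' S)) := by
    ext y
    have hy : ∑ i, a i * φ y i = b := by
      have : φ y ∈ Set.range φ := ⟨y, rfl⟩
      rwa [hrange] at this
    rw [Set.mem_preimage, hmem _ hy]
    simp only [hφ_apply]
    rfl
  rw [← hrange, Set.inter_comm, ← hφ.euclideanHausdorffMeasure_preimage,
    EuclideanSpace.euclideanHausdorffMeasure_eq_volume, hpre,
    (PiLp.volume_preserving_ofLp (Fin n)).measure_preimage_equiv
      (f := (MeasurableEquiv.toLp 2 (Fin n → ℝ)).symm),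
    Measure.addHaar_preimage_linearMap _ hN0, measure_preimage_add_right, LinearMap.det_toLin',
    abs_inv, hN]

/-! ### Volumes of corner simplices and of prisms over them -/

lemma integral_sub_mul_pow (b a c : ℝ) (m : ℕ) :
    ∫ s in (0 : ℝ)..c, (b - a * s) ^ m = c * prismSum b (a * c) (m + 1) / (m + 1) := by
  rcases eq_or_ne a 0 with rfl | ha
  · have : (m : ℝ) + 1 ≠ 0 := by positivity
    simp [prismSum, ← pow_add]
    rw [Finset.sum_congr rfl (g := fun _ => b ^ m)]
    · simp
      field_simp
    · intro i hi
      rw [Finset.mem_range] at hi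
      congr 1
      omega
  · have h := intervalIntegral.integral_comp_sub_mul (f := fun x => x ^ m) (a := 0) (b := c) ha b
    rw [h, integral_pow]
    have hg := (Commute.all (b - a * c) b).geom_sum₂_mul (m + 1)
    have hp : prismSum b (a * c) (m + 1) * (a * c) = b ^ (m + 1) - (b - a * c) ^ (m + 1) := by
      rw [prismSum]
      linear_combination -hg
    have : (m : ℝ) + 1 ≠ 0 := by positivity
    simp only [mul_zero, sub_zero, smul_eq_mul]
    field_simp
    linear_combination -hp

lemma prismSum_self (b : ℝ) (m : ℕ) : prismSum b b (m + 1) = b ^ m := by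
  simp [prismSum, Finset.sum_range_succ']

/-- Slicing orthogonally to the first axis: if the slices at height `s ∈ [0, c]` are corner
simplices of size `b - a 0 * s`, their volumes integrate to a `prismSum`. -/
lemma volume_slices {m : ℕ} (a : Fin (m + 1) → ℝ) (b c K : ℝ) (hK : 0 ≤ K) (hc : 0 ≤ c)
    (ha : 0 ≤ a 0) (hac : a 0 * c ≤ b)
    (hvol : ∀ r, 0 ≤ r → volume {y : Fin m → ℝ | (∀ i, 0 ≤ y i) ∧ ∑ i, a i.succ * y i ≤ r} =
      ENNReal.ofReal (r ^ m * K)) :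
    volume {y : Fin (m + 1) → ℝ | (∀ i, 0 ≤ y i) ∧ y 0 ≤ c ∧ ∑ i, a i * y i ≤ b} =
      ENNReal.ofReal (c * prismSum b (a 0 * c) (m + 1) / (m + 1) * K) := by
  set A := {y : Fin (m + 1) → ℝ | (∀ i, 0 ≤ y i) ∧ y 0 ≤ c ∧ ∑ i, a i * y i ≤ b} with hA
  have hAm : MeasurableSet A := by
    have h1 : IsClosed {y : Fin (m + 1) → ℝ | ∀ i, 0 ≤ y i} := by
      simp only [Set.ofPred_forall]
      exact isClosed_iInter fun i => isClosed_le continuous_const (continuous_apply i)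
    have h2 : IsClosed {y : Fin (m + 1) → ℝ | y 0 ≤ c} :=
      isClosed_le (continuous_apply 0) continuous_const
    have h3 : IsClosed {y : Fin (m + 1) → ℝ | ∑ i, a i * y i ≤ b} :=
      isClosed_le (by fun_prop) continuous_const
    exact (h1.inter (h2.inter h3)).measurableSet
  let e := MeasurableEquiv.piFinSuccAbove (fun _ : Fin (m + 1) => ℝ) 0
  have he := (volume_preserving_piFinSuccAbove (fun _ : Fin (m + 1) => ℝ) 0).symm
  rw [← he.measure_preimage_equiv, Measure.volume_eq_prod,
    Measure.prod_apply (e.symm.measurable hAm)]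
  have hslice : ∀ s : ℝ, volume (Prod.mk s ⁻¹' (e.symm ⁻¹' A)) =
      (Set.Icc 0 c).indicator (fun s => ENNReal.ofReal ((b - a 0 * s) ^ m * K)) s := by
    intro s
    have hset : Prod.mk s ⁻¹' (e.symm ⁻¹' A) = {y : Fin m → ℝ | s ∈ Set.Icc 0 c ∧
        (∀ i, 0 ≤ y i) ∧ ∑ i, a i.succ * y i ≤ b - a 0 * s} := by
      ext y
      simp only [hA, e, Set.mem_preimage, Set.mem_ofPred_eq, Fin.forall_fin_succ, Fin.sum_univ_succ,
        Set.mem_Icc]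
      have h0 : (MeasurableEquiv.piFinSuccAbove (fun _ : Fin (m + 1) => ℝ) 0).symm (s, y) 0 = s :=
        rfl
      have h1 : ∀ i : Fin m, (MeasurableEquiv.piFinSuccAbove (fun _ : Fin (m + 1) => ℝ) 0).symm
        (s, y) i.succ = y i := fun i => rfl
      simp only [h0, h1]
      constructor
      · rintro ⟨⟨p, q⟩, r, t⟩
        exact ⟨⟨p, r⟩, q, by linarith⟩
      · rintro ⟨⟨p, r⟩, q, t⟩
        exact ⟨⟨p, q⟩, r, by linarith⟩
    rw [hset]
    by_cases hs : s ∈ Set.Icc 0 c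
    · rw [Set.indicator_of_mem hs, ← hvol _ (by nlinarith [hs.1, hs.2])]
      simp [hs]
    · rw [Set.indicator_of_notMem hs]
      simp [hs]
  change ∫⁻ s : ℝ, volume (Prod.mk s ⁻¹' (e.symm ⁻¹' A)) = _
  simp_rw [hslice]
  rw [lintegral_indicator measurableSet_Icc, ← ofReal_integral_eq_lintegral_ofReal,
    integral_Icc_eq_integral_Ioc, ← intervalIntegral.integral_of_le hc,
    intervalIntegral.integral_mul_const, integral_sub_mul_pow]
  · exact (Continuous.continuousOn (by fun_prop)).integrableOn_Icc
  · filter_upwards [ae_restrict_mem measurableSet_Icc] with s hs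
    have : 0 ≤ b - a 0 * s := by nlinarith [hs.1, hs.2]
    positivity

/-- The volume of the corner simplex with vertices `0` and `(b / a i) • e i`. -/
lemma volume_corner_simplex {m : ℕ} (a : Fin m → ℝ) (ha : ∀ i, 0 < a i) (b : ℝ) (hb : 0 ≤ b) :
    volume {y : Fin m → ℝ | (∀ i, 0 ≤ y i) ∧ ∑ i, a i * y i ≤ b} =
      ENNReal.ofReal (b ^ m * (m.factorial * ∏ i, a i)⁻¹) := by
  induction m generalizing b with
  | zero => simp [hb, volume_pi]
  | succ m ih =>
    have hK : 0 < ∏ i : Fin m, a i.succ := Finset.prod_pos fun i _ => ha _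
    have h := volume_slices a b (b / a 0) (m.factorial * ∏ i : Fin m, a i.succ)⁻¹ (by positivity)
      (div_nonneg hb (ha 0).le) (ha 0).le (mul_div_cancel₀ b (ha 0).ne').le
      (fun r hr => ih (fun i => a i.succ) (fun i => ha _) r hr)
    rw [mul_div_cancel₀ b (ha 0).ne', prismSum_self] at h
    convert! h using 2
    · ext y
      simp only [Set.mem_ofPred_eq]
      refine and_congr_right fun hy => ⟨fun h => ⟨?_, h⟩, fun h => h.2⟩
      rw [le_div_iff₀ (ha 0), mul_comm]
      exact (Finset.single_le_sum (f := fun i => a i * y i)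
        (fun i _ => mul_nonneg (ha i).le (hy i)) (Finset.mem_univ 0)).trans h
    · rw [Fin.prod_univ_succ, Nat.factorial_succ]
      have := (ha 0).ne'
      push_cast
      field_simp
      ring

/-- The volume of a corner simplex truncated by `y j ≤ 1`. The coefficient `a j` may vanish. -/
lemma volume_truncated_simplex {m : ℕ} (a : Fin (m + 1) → ℝ) (j : Fin (m + 1)) (b : ℝ)
    (haj : 0 ≤ a j) (hajb : a j ≤ b) (ha : ∀ i ≠ j, 0 < a i) :
    volume {y : Fin (m + 1) → ℝ | (∀ i, 0 ≤ y i) ∧ y j ≤ 1 ∧ ∑ i, a i * y i ≤ b} =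
      ENNReal.ofReal (prismSum b (a j) (m + 1) *
        ((m + 1).factorial * ∏ i ∈ Finset.univ.erase j, a i)⁻¹) := by
  -- Transpose the coordinates `0` and `j`.
  let σ : Equiv.Perm (Fin (m + 1)) := Equiv.swap 0 j
  have hpos : ∀ i : Fin m, 0 < a (σ i.succ) := fun i => ha _ fun h => by
    have := σ.injective (h.trans (Equiv.swap_apply_left 0 j).symm)
    exact Fin.succ_ne_zero i this
  have hK : 0 < ∏ i : Fin m, a (σ i.succ) := Finset.prod_pos fun i _ => hpos i
  have h := volume_slices (fun i => a (σ i)) b 1 (m.factorial * ∏ i : Fin m, a (σ i.succ))⁻¹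
    (by positivity) zero_le_one (by simpa [σ] using haj) (by simpa [σ] using hajb)
    (fun r hr => volume_corner_simplex (fun i => a (σ i.succ)) hpos r hr)
  have hprod : ∏ i ∈ Finset.univ.erase j, a i = ∏ i : Fin m, a (σ i.succ) := by
    have h1 : ∏ i ∈ Finset.univ.erase 0, a (σ i) = ∏ i ∈ Finset.univ.erase j, a i := by
      refine Finset.prod_equiv σ (fun i => ?_) (fun _ _ => rfl)
      simp [σ, Equiv.swap_apply_eq_iff]
    rw [← h1, Finset.erase_eq, ← Finset.compl_eq_univ_sdiff, ← Fin.image_succ_univ,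
      Finset.prod_image (Fin.succ_injective m).injOn]
  rw [← (volume_measurePreserving_piCongrLeft (fun _ : Fin (m + 1) => ℝ) σ).measure_preimage_equiv]
  convert! h using 2
  · ext y
    have hy : ∀ i, MeasurableEquiv.piCongrLeft (fun _ : Fin (m + 1) => ℝ) σ y (σ i) = y i :=
      fun i => Equiv.piCongrLeft_apply_apply (fun _ : Fin (m + 1) => ℝ) σ y i
    have hj : MeasurableEquiv.piCongrLeft (fun _ : Fin (m + 1) => ℝ) σ y j = y 0 := by
      rw [← hy 0]
      simp [σ]
    simp only [Set.mem_preimage, Set.mem_ofPred_eq, hj]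
    rw [← σ.forall_congr_right, ← Equiv.sum_comp σ]
    simp only [hy]
  · rw [hprod, Nat.factorial_succ]
    simp only [σ, Equiv.swap_apply_left]
    push_cast
    field_simp

/-! ### Normal form of the hyperplane -/

/-- A hyperplane at distance `t > 0` from the center of the cube has a normal vector `u` of norm
`√d` pointing from the hyperplane to the center. -/
lemma exists_normal {d : ℕ} {t : ℝ} (ht : 0 < t)
    {H : AffineSubspace ℝ (EuclideanSpace ℝ (Fin d))} (hH : IsHyperplane H)
    (hdist : Metric.infDist (center d) (H : Set (EuclideanSpace ℝ (Fin d))) = t) :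
    ∃ u : Fin d → ℝ, ∑ i, u i ^ 2 = d ∧
      (H : Set (EuclideanSpace ℝ (Fin d))) = {x | ∑ i, u i * (x i - 1 / 2) = -(√d * t)} := by
  obtain ⟨hne, hfin⟩ := hH
  have : Nonempty H := hne.to_subtype
  set c := center d with hc
  let p : EuclideanSpace ℝ (Fin d) := EuclideanGeometry.orthogonalProjection H c
  have hpH : p ∈ H := EuclideanGeometry.orthogonalProjection_mem c
  set w : EuclideanSpace ℝ (Fin d) := c - p with hw
  have hw_orth : w ∈ H.directionᗮ := by
    have := EuclideanGeometry.vsub_orthogonalProjection_mem_direction_orthogonal H c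
    simpa [hw, p] using this
  have hw_norm : ‖w‖ = t := by
    rw [← hdist, ← EuclideanGeometry.dist_orthogonalProjection_eq_infDist,
      dist_eq_norm, norm_sub_rev]
  have hw0 : w ≠ 0 := by
    rw [← norm_pos_iff, hw_norm]
    exact ht
  have hspan : H.directionᗮ = Submodule.span ℝ {w} := by
    symm
    apply Submodule.eq_of_le_of_finrank_eq
    · rwa [Submodule.span_singleton_le_iff_mem]
    · rw [finrank_span_singleton hw0]
      have := H.direction.finrank_add_finrank_orthogonal
      rw [finrank_euclideanSpace_fin] at this
      omega
  have hdir : ∀ v, v ∈ H.direction ↔ inner ℝ w v = 0 := by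
    intro v
    rw [← Submodule.orthogonal_orthogonal H.direction, hspan,
      Submodule.mem_orthogonal_singleton_iff_inner_right]
  have hinner : ∀ x : EuclideanSpace ℝ (Fin d), inner ℝ w (x - c) = ∑ i, w i * (x i - 1 / 2) := by
    intro x
    rw [EuclideanSpace.inner_eq_star_dotProduct]
    simp [dotProduct, hc, center, mul_comm]
  have hmem : ∀ x, x ∈ H ↔ ∑ i, w i * (x i - 1 / 2) = -t ^ 2 := by
    intro x
    rw [← hinner, ← AffineSubspace.vsub_right_mem_direction_iff_mem hpH, hdir, vsub_eq_sub,
      show x - p = (x - c) + w by rw [hw]; abel, inner_add_right, real_inner_self_eq_norm_sq,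
      hw_norm]
    constructor <;> intro h <;> linarith
  have hnorm : ∑ i, w i ^ 2 = t ^ 2 := by
    rw [← hw_norm, EuclideanSpace.norm_sq_eq]
    simp
  refine ⟨fun i => √d / t * w i, ?_, ?_⟩
  · simp_rw [mul_pow, ← Finset.mul_sum, hnorm, div_pow]
    rw [Real.sq_sqrt (by positivity)]
    field_simp
  · ext x
    rw [SetLike.mem_coe, hmem, Set.mem_ofPred_eq]
    simp_rw [mul_assoc, ← Finset.mul_sum]
    generalize ∑ i, w i * (x i - 1 / 2) = S
    have hd : 0 < √(d : ℝ) := Real.sqrt_pos.2 (by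
      have : 0 < d := by omega
      exact_mod_cast this)
    constructor
    · intro h
      rw [h]
      field_simp
    · intro h
      field_simp at h
      linarith

lemma isOrthogonalToDiagonal_iff {d : ℕ} {H : AffineSubspace ℝ (EuclideanSpace ℝ (Fin d))}
    (hne : (H : Set (EuclideanSpace ℝ (Fin d))).Nonempty) {u : Fin d → ℝ} {s : ℝ}
    (hu : ∑ i, u i ^ 2 = d)
    (hHu : (H : Set (EuclideanSpace ℝ (Fin d))) = {x | ∑ i, u i * (x i - 1 / 2) = s}) :
    IsOrthogonalToDiagonal H ↔ ∀ i, |u i| = 1 := by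
  obtain ⟨p, hp⟩ := hne
  have hdir : H.direction = (Submodule.span ℝ {WithLp.toLp 2 u})ᗮ := by
    ext v
    have hps : ∑ i, u i * (p i - 1 / 2) = s := by
      rw [hHu] at hp
      exact hp
    rw [← AffineSubspace.vadd_mem_iff_mem_direction v hp, ← SetLike.mem_coe, hHu,
      Submodule.mem_orthogonal_singleton_iff_inner_right, EuclideanSpace.inner_eq_star_dotProduct,
      Set.mem_ofPred_eq, ← hps]
    have : ∑ i, u i * ((v +ᵥ p) i - 1 / 2) = ∑ i, u i * v i + ∑ i, u i * (p i - 1 / 2) := by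
      rw [← Finset.sum_add_distrib]
      refine Finset.sum_congr rfl fun i _ => ?_
      simp only [vadd_eq_add, PiLp.add_apply]
      ring
    rw [this]
    simp [dotProduct, mul_comm]
  constructor
  · rintro ⟨v, w, ⟨hv, hw, hmid⟩, horth⟩
    -- The direction of the diagonal has all its coordinates equal to `± 1`.
    have hvw : ∀ i, |w i - v i| = 1 := by
      intro i
      have h := congrFun (congrArg WithLp.ofLp hmid) i
      have h' : v i + w i = 1 := by
        simp [midpoint_eq_smul_add, center] at h
        linarith
      rcases hv i with h1 | h1
      · rw [h1, show w i = 1 by linarith]; norm_num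
      · rw [h1, show w i = 0 by linarith]; norm_num
    have hmem : w - v ∈ Submodule.span ℝ {WithLp.toLp 2 u} := by
      rw [← Submodule.orthogonal_orthogonal (Submodule.span ℝ {WithLp.toLp 2 u}), ← hdir]
      exact horth.symm (by
        rw [direction_affineSpan]
        exact vsub_mem_vectorSpan ℝ (by simp) (by simp))
    obtain ⟨r, hr⟩ := Submodule.mem_span_singleton.1 hmem
    have hri : ∀ i, r * u i = w i - v i := fun i => by
      have := congrFun (congrArg WithLp.ofLp hr) i
      simpa using this
    intro i
    have hd : (d : ℝ) ≠ 0 := by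
      have := i.pos
      exact_mod_cast this.ne'
    have hr2 : r ^ 2 = 1 := by
      have h1 : ∑ k, (r * u k) ^ 2 = d := by
        simp_rw [hri, ← sq_abs (w _ - v _), hvw]
        simp
      simp_rw [mul_pow, ← Finset.mul_sum, hu] at h1
      exact mul_right_cancel₀ hd (by rw [h1, one_mul])
    have h2 : |r| = 1 := by
      rcases mul_self_eq_one_iff.1 ((sq r).symm.trans hr2) with h | h <;> simp [h]
    have := hvw i
    rwa [← hri, abs_mul, h2, one_mul] at this
  · intro h
    have hu1 : ∀ i, u i = 1 ∨ u i = -1 := fun i => eq_or_eq_neg_of_abs_eq (h i)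
    refine ⟨WithLp.toLp 2 fun i => (1 - u i) / 2, WithLp.toLp 2 fun i => (1 + u i) / 2,
      ⟨fun i => ?_, fun i => ?_, ?_⟩, ?_⟩
    · rcases hu1 i with h | h <;> simp [h]
    · rcases hu1 i with h | h <;> simp [h]
    · ext i
      simp [midpoint_eq_smul_add, center]
      ring
    · rw [hdir, direction_affineSpan, vectorSpan_pair_rev]
      refine (Submodule.isOrtho_orthogonal_left _).mono_right ?_
      rw [Submodule.span_singleton_le_iff_mem]
      convert! Submodule.mem_span_singleton_self (WithLp.toLp 2 u) using 1
      ext i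
      simp
      ring

/-- Reflections of the cube make the normal vector nonnegative. -/
lemma sectionVolume_abs {d n : ℕ} (u : Fin d → ℝ) (s : ℝ) :
    μHE[n] ({x : EuclideanSpace ℝ (Fin d) | ∑ i, u i * (x i - 1 / 2) = s} ∩ cube d) =
      μHE[n] ({x : EuclideanSpace ℝ (Fin d) | ∑ i, |u i| * (x i - 1 / 2) = s} ∩ cube d) := by
  classical
  let ρ : EuclideanSpace ℝ (Fin d) → EuclideanSpace ℝ (Fin d) :=
    fun x => WithLp.toLp 2 fun i => if 0 ≤ u i then x i else 1 - x i
  have hρ_apply : ∀ x i, ρ x i = if 0 ≤ u i then x i else 1 - x i := fun _ _ => rfl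
  have hρ : Isometry ρ := by
    refine Isometry.of_dist_eq fun x y => ?_
    rw [EuclideanSpace.dist_eq, EuclideanSpace.dist_eq]
    congr 1
    refine Finset.sum_congr rfl fun i _ => ?_
    rw [hρ_apply, hρ_apply]
    split_ifs
    · rfl
    · rw [dist_sub_left]
  have hinv : Function.Involutive ρ := fun x => by
    ext i
    rw [hρ_apply, hρ_apply]
    split_ifs <;> simp
  have hpre : {x : EuclideanSpace ℝ (Fin d) | ∑ i, u i * (x i - 1 / 2) = s} ∩ cube d =
      ρ ⁻¹' ({x : EuclideanSpace ℝ (Fin d) | ∑ i, |u i| * (x i - 1 / 2) = s} ∩ cube d) := by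
    ext x
    simp only [Set.mem_inter_iff, Set.mem_preimage, Set.mem_ofPred_eq, cube, hρ_apply, Set.mem_Icc]
    refine and_congr (Eq.congr_left (Finset.sum_congr rfl fun i _ => ?_))
      (forall_congr' fun i => ?_)
    · split_ifs with h
      · rw [abs_of_nonneg h]
      · rw [abs_of_neg (not_le.1 h)]
        ring
    · split_ifs with h
      · rfl
      · constructor <;> rintro ⟨h1, h2⟩ <;> constructor <;> linarith
  rw [hpre, hρ.euclideanHausdorffMeasure_preimage, hinv.surjective.range_eq, Set.inter_univ]

/-! ### Sections with a nonnegative normal vector -/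

/-- The section volume in terms of a coordinate projection, for a normal vector of norm `√D`. -/
lemma section_eq_projection {n : ℕ} (u : Fin (n + 1) → ℝ) {D : ℝ} (hD : 0 < D)
    (hu2 : ∑ i, u i ^ 2 = D) (b : ℝ) (j : Fin (n + 1)) (hj : 0 < u j) :
    μHE[n] ({x : EuclideanSpace ℝ (Fin (n + 1)) | ∑ i, u i * x i = b} ∩ cube (n + 1)) =
      ENNReal.ofReal (√D / u j) * volume {y : Fin n → ℝ |
        (b - ∑ k, u (j.succAbove k) * y k) / u j ∈ Set.Icc (0 : ℝ) 1 ∧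
          ∀ k, y k ∈ Set.Icc (0 : ℝ) 1} := by
  have hs : 0 < √D := Real.sqrt_pos.2 hD
  have h := euclideanHausdorffMeasure_hyperplane_inter (fun i => u i / √D)
    (by simp_rw [div_pow, ← Finset.sum_div, hu2, Real.sq_sqrt hD.le]; exact div_self hD.ne')
    (b / √D) j (by positivity) (cube (n + 1))
  have hset : {x : EuclideanSpace ℝ (Fin (n + 1)) | ∑ i, u i / √D * x i = b / √D} =
      {x | ∑ i, u i * x i = b} := by
    ext x
    simp only [Set.mem_ofPred_eq, div_mul_eq_mul_div, ← Finset.sum_div]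
    exact div_left_inj' hs.ne'
  rw [hset] at h
  rw [h, abs_of_pos (div_pos hj hs), inv_div]
  congr 2
  ext y
  simp only [cube, Set.mem_ofPred_eq, Fin.forall_iff_succAbove j, Fin.insertNth_apply_same,
    Fin.insertNth_apply_succAbove, div_mul_eq_mul_div, ← Finset.sum_div, ← sub_div]
  rw [div_div_div_cancel_right₀ hs.ne']

/-- A hyperplane that cuts off only the vertex `0`: the section projects to a corner simplex. -/
lemma section_eq_of_forall_le {n : ℕ} (u : Fin (n + 1) → ℝ) {D : ℝ} (hD : 0 < D)
    (hu2 : ∑ i, u i ^ 2 = D) {b : ℝ} (hb : 0 ≤ b) (hu : ∀ i, 0 < u i) (hbu : ∀ i, b ≤ u i) :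
    μHE[n] ({x : EuclideanSpace ℝ (Fin (n + 1)) | ∑ i, u i * x i = b} ∩ cube (n + 1)) =
      ENNReal.ofReal (√D * (b ^ n / (n.factorial * ∏ i, u i))) := by
  have hset : {y : Fin n → ℝ | (b - ∑ k, u (Fin.succAbove 0 k) * y k) / u 0 ∈ Set.Icc (0 : ℝ) 1 ∧
      ∀ k, y k ∈ Set.Icc (0 : ℝ) 1} =
      {y | (∀ k, 0 ≤ y k) ∧ ∑ k, u (Fin.succAbove 0 k) * y k ≤ b} := by
    ext y
    simp only [Set.mem_ofPred_eq, Set.mem_Icc, le_div_iff₀ (hu 0), div_le_iff₀ (hu 0)]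
    constructor
    · rintro ⟨⟨h1, -⟩, h2⟩
      exact ⟨fun k => (h2 k).1, by linarith⟩
    · rintro ⟨h1, h2⟩
      have hterm : ∀ k, 0 ≤ u (Fin.succAbove 0 k) * y k := fun k =>
        mul_nonneg (hu _).le (h1 k)
      have hsum : 0 ≤ ∑ k, u (Fin.succAbove 0 k) * y k := Finset.sum_nonneg fun k _ => hterm k
      refine ⟨⟨by linarith, by linarith [hbu 0]⟩, fun k => ⟨h1 k, ?_⟩⟩
      have h3 : u (Fin.succAbove 0 k) * y k ≤ u (Fin.succAbove 0 k) * 1 := by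
        have := Finset.single_le_sum (fun i _ => hterm i) (Finset.mem_univ k)
        linarith [hbu (Fin.succAbove 0 k)]
      exact le_of_mul_le_mul_left h3 (hu _)
  have hprod : 0 < ∏ k, u (Fin.succAbove 0 k) := Finset.prod_pos fun k _ => hu _
  rw [section_eq_projection u hD hu2 b 0 (hu 0), hset,
    volume_corner_simplex (fun k => u (Fin.succAbove 0 k)) (fun k => hu _) b hb,
    ← ENNReal.ofReal_mul (div_nonneg (Real.sqrt_nonneg _) (hu 0).le),
    Fin.prod_univ_succAbove _ 0]
  congr 1
  have := (hu 0).ne'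
  field_simp

/-- A hyperplane that cuts off the vertices `0` and `e j`: the section projects into a truncated
simplex. -/
lemma section_le_prism {m : ℕ} (u : Fin (m + 2) → ℝ) {D : ℝ} (hD : 0 < D)
    (hu2 : ∑ i, u i ^ 2 = D) {b : ℝ} (j : Fin (m + 2)) (huj : 0 ≤ u j) (hujb : u j ≤ b)
    (hu : ∀ i ≠ j, 0 < u i) :
    μHE[m + 1] ({x : EuclideanSpace ℝ (Fin (m + 2)) | ∑ i, u i * x i = b} ∩ cube (m + 2)) ≤
      ENNReal.ofReal (√D * (prismSum b (u j) (m + 1) /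
        ((m + 1).factorial * ∏ i ∈ Finset.univ.erase j, u i))) := by
  obtain ⟨l, hl⟩ := exists_ne j
  obtain ⟨k, rfl⟩ := Fin.exists_succAbove_eq hl.symm
  have hpos : ∀ i ≠ k, 0 < u (l.succAbove i) := fun i hi =>
    hu _ fun h => hi (Fin.succAbove_right_injective h)
  have hprod : ∏ i ∈ Finset.univ.erase (l.succAbove k), u i =
      u l * ∏ i ∈ Finset.univ.erase k, u (l.succAbove i) := by
    rw [← Finset.mul_prod_erase _ u (Finset.mem_erase.2 ⟨hl, Finset.mem_univ l⟩)]
    congr 1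
    rw [← Finset.prod_image (f := u) (s := Finset.univ.erase k) (g := l.succAbove)
      Fin.succAbove_right_injective.injOn]
    congr 1
    ext i
    refine Fin.succAboveCases l ?_ (fun i => ?_) i
    · simp [Fin.succAbove_ne]
    · simp [Fin.succAbove_ne]
  have hvol := volume_truncated_simplex (fun i => u (l.succAbove i)) k b huj hujb hpos
  have hprod0 : 0 < ∏ i ∈ Finset.univ.erase k, u (l.succAbove i) :=
    Finset.prod_pos fun i hi => hpos i (Finset.ne_of_mem_erase hi)
  rw [section_eq_projection u hD hu2 b l (hu l hl)]
  calc _ ≤ ENNReal.ofReal (√D / u l) * volume {y : Fin (m + 1) → ℝ |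
        (∀ i, 0 ≤ y i) ∧ y k ≤ 1 ∧ ∑ i, u (l.succAbove i) * y i ≤ b} := by
        refine mul_le_mul' le_rfl (measure_mono ?_)
        rintro y ⟨h1, h2⟩
        rw [Set.mem_Icc, le_div_iff₀ (hu l hl)] at h1
        exact ⟨fun i => (h2 i).1, (h2 k).2, by linarith [h1.1]⟩
    _ = _ := by
        rw [hvol, ← ENNReal.ofReal_mul (div_nonneg (Real.sqrt_nonneg _) (hu l hl).le), hprod]
        congr 1
        have := (hu l hl).ne'
        field_simp

/-- The center of a two-dimensional face is at distance `√(d - 2) / 2` from the center of the cube.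
A hyperplane that is further away does not separate the two, so that it cuts off at most one of the
vertices `e i` and `e j`. -/
lemma two_mul_lt_add {d : ℕ} (hd : 2 ≤ d) {u : Fin d → ℝ} {t b : ℝ}
    (hu2 : ∑ i, u i ^ 2 = d) (ht : √((d : ℝ) - 2) / 2 < t)
    (hb : b = (∑ i, u i) / 2 - √d * t) {i j : Fin d} (hij : i ≠ j) : 2 * b < u i + u j := by
  classical
  have hd' : (2 : ℝ) ≤ d := by exact_mod_cast hd
  set F := (Finset.univ.erase i).erase j with hF
  have hj : j ∈ Finset.univ.erase i := Finset.mem_erase.2 ⟨hij.symm, Finset.mem_univ j⟩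
  have hcard : (F.card : ℝ) = d - 2 := by
    rw [hF, Finset.card_erase_of_mem hj, Finset.card_erase_of_mem (Finset.mem_univ i),
      Finset.card_univ, Fintype.card_fin, Nat.sub_sub, Nat.cast_sub hd]
    norm_num
  have hsum : ∑ k, u k = u i + (u j + ∑ k ∈ F, u k) := by
    rw [← Finset.add_sum_erase _ u (Finset.mem_univ i), ← Finset.add_sum_erase _ u hj]
  have hsq : ∑ k ∈ F, u k ^ 2 ≤ d := by
    rw [← hu2]
    exact Finset.sum_le_univ_sum_of_nonneg fun k => sq_nonneg _
  have hcs : (∑ k ∈ F, u k) ^ 2 ≤ (d - 2) * d := by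
    refine (sq_sum_le_card_mul_sum_sq (s := F) (f := u)).trans ?_
    rw [hcard]
    exact mul_le_mul_of_nonneg_left hsq (by linarith)
  have hle : ∑ k ∈ F, u k ≤ √((d : ℝ) - 2) * √d := by
    rw [← Real.sqrt_mul (by linarith)]
    exact Real.le_sqrt_of_sq_le hcs
  have hs : 0 < √(d : ℝ) := Real.sqrt_pos.2 (by linarith)
  nlinarith

lemma sqrt_mul_sub_le {d t : ℝ} (hd : 5 ≤ d) (ht : √(d - 2) / 2 < t) :
    √d * (√d / 2 - t) ≤ 1409 / 2500 := by
  have h1 : d - 2818 / 2500 ≤ √d * √(d - 2) := by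
    rw [← Real.sqrt_mul (by linarith)]
    exact Real.le_sqrt_of_sq_le (by nlinarith)
  have h2 : √d * √d = d := Real.mul_self_sqrt (by linarith)
  nlinarith [Real.sqrt_nonneg d]

/-- The bound and its equality case for a nonnegative normal vector. -/
lemma section_bound_of_nonneg {n : ℕ} (hn : 4 ≤ n) {t : ℝ} (u : Fin (n + 1) → ℝ)
    (hu : ∀ i, 0 ≤ u i) (hu2 : ∑ i, u i ^ 2 = ((n + 1 : ℕ) : ℝ))
    (ht₁ : √(((n + 1 : ℕ) : ℝ) - 2) / 2 < t) (ht₂ : t < √((n + 1 : ℕ) : ℝ) / 2) :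
    let V := μHE[n] ({x : EuclideanSpace ℝ (Fin (n + 1)) |
      ∑ i, u i * (x i - 1 / 2) = -(√((n + 1 : ℕ) : ℝ) * t)} ∩ cube (n + 1))
    let T := √((n + 1 : ℕ) : ℝ) * (√((n + 1 : ℕ) : ℝ) / 2 - t)
    let R := ENNReal.ofReal (√((n + 1 : ℕ) : ℝ) * (T ^ n / n.factorial))
    V ≤ R ∧ (V = R ↔ ∀ i, u i = 1) := by
  intro V T R
  set D : ℝ := ((n + 1 : ℕ) : ℝ) with hD_def
  have hD5 : 5 ≤ D := by
    rw [hD_def]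
    exact_mod_cast Nat.succ_le_succ hn
  have hD : 0 < D := by linarith
  have hs : 0 < √D := Real.sqrt_pos.2 hD
  have hDs : √D * √D = D := Real.mul_self_sqrt hD.le
  have hcard : (Fintype.card (Fin (n + 1)) : ℝ) = D := by rw [Fintype.card_fin]
  set b := (∑ i, u i) / 2 - √D * t with hb
  have hTb : T = b + (D - ∑ i, u i) / 2 := by
    simp only [T, hb]
    linear_combination (1 / 2 : ℝ) * hDs
  have hT0 : 0 < T := mul_pos hs (by linarith)
  have hτ : T ≤ 1409 / 2500 := sqrt_mul_sub_le hD5 ht₁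
  have hpair : ∀ {i j : Fin (n + 1)}, i ≠ j → 2 * b < u i + u j := fun hij =>
    two_mul_lt_add (by omega) hu2 ht₁ hb hij
  have hR0 : 0 < √D * (T ^ n / n.factorial) := by positivity
  have hV : V = μHE[n] ({x : EuclideanSpace ℝ (Fin (n + 1)) | ∑ i, u i * x i = b} ∩
      cube (n + 1)) := by
    simp only [V]
    congr 2
    ext x
    simp only [Set.mem_ofPred_eq, mul_sub, Finset.sum_sub_distrib, ← Finset.sum_mul, hb]
    constructor <;> intro h <;> linarith
  -- It remains to prove a strict inequality unless all coordinates of `u` are `1`.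
  have hstrict : V < R → ¬ (∀ i, u i = 1) → V ≤ R ∧ (V = R ↔ ∀ i, u i = 1) := fun h h' =>
    ⟨h.le, iff_of_false h.ne h'⟩
  have hofReal : ∀ {x y : ℝ}, V ≤ ENNReal.ofReal (√D * (x / (n.factorial * y))) → 0 < y →
      x < T ^ n * y → V < R := by
    intro x y hVx hy hxy
    refine hVx.trans_lt ((ENNReal.ofReal_lt_ofReal_iff hR0).2 ?_)
    refine mul_lt_mul_of_pos_left ?_ hs
    rw [mul_comm (n.factorial : ℝ), ← div_div]
    refine div_lt_div_of_pos_right ?_ (by positivity)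
    rwa [div_lt_iff₀ hy]
  have hb_of_one : (∀ i, u i = 1) → T = b := by
    intro h
    have : ∑ i, u i = D := by simp [h, hD_def]
    rw [hTb, this]
    ring
  rcases lt_or_ge b 0 with hb0 | hb0
  · refine hstrict ?_ fun h => by linarith [hb_of_one h]
    have : {x : EuclideanSpace ℝ (Fin (n + 1)) | ∑ i, u i * x i = b} ∩ cube (n + 1) = ∅ := by
      ext x
      simp only [Set.mem_inter_iff, Set.mem_ofPred_eq, Set.mem_empty_iff_false, iff_false, not_and]
      intro hx hxc
      have : 0 ≤ ∑ i, u i * x i := Finset.sum_nonneg fun i _ => mul_nonneg (hu i) (hxc i).1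
      linarith
    rw [hV, this, measure_empty]
    exact ENNReal.ofReal_pos.2 hR0
  by_cases hA : ∀ i, 0 < u i ∧ b ≤ u i
  · have hVA := section_eq_of_forall_le u hD hu2 hb0 (fun i => (hA i).1) (fun i => (hA i).2)
    rw [← hV] at hVA
    by_cases h1 : ∀ i, u i = 1
    · have : V = R := by
        rw [hVA, ← hb_of_one h1]
        simp only [R, h1, Finset.prod_const_one, mul_one]
        rfl
      exact ⟨this.le, iff_of_true this h1⟩
    · refine hstrict (hofReal hVA.le (Finset.prod_pos fun i _ => (hA i).1) ?_) h1
      push Not at h1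
      exact pow_lt_mul_prod hn (by rw [hu2, hcard]) (by rw [hcard, hTb]) hτ hb0
        (fun i => (hA i).2) (fun i => (hA i).1) h1
  · push Not at hA
    obtain ⟨j, hj⟩ := hA
    have hjb : u j ≤ b := by
      rcases (hu j).eq_or_lt with h | h
      · rw [← h]
        exact hb0
      · exact (hj h).le
    have hbu : ∀ i ≠ j, b < u i := fun i hi => by linarith [hpair hi]
    have hδ : 0 ≤ (D - ∑ i, u i) / 2 := by
      have h := sum_one_sub_sq (u := u) (by rw [hu2, hcard])
      rw [hcard] at h
      have : 0 ≤ ∑ i, (1 - u i) ^ 2 := Finset.sum_nonneg fun _ _ => sq_nonneg _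
      linarith
    obtain ⟨m, rfl⟩ : ∃ m, n = m + 1 := ⟨n - 1, by omega⟩
    have hVB := section_le_prism u hD hu2 j (hu j) hjb fun i hi => hb0.trans_lt (hbu i hi)
    rw [← hV] at hVB
    refine hstrict (hofReal hVB (Finset.prod_pos fun i hi =>
      hb0.trans_lt (hbu i (Finset.ne_of_mem_erase hi))) ?_) fun h => by linarith [h j]
    exact prismSum_lt_mul_prod hn (by rw [hu2, hcard]) (by rw [hcard, hTb]) hT0 hτ j (hu j) hjb
      (fun i hi => (hbu i hi).le) fun i hi => hb0.trans_lt (hbu i hi)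

end Hypercube

theorem mainTheorem1 (d : ℕ) (hd : 5 ≤ d) (t : ℝ)
    (ht₁ : √((d : ℝ) - 2) / 2 < t) (ht₂ : t < √(d : ℝ) / 2)
    (H : AffineSubspace ℝ (EuclideanSpace ℝ (Fin d))) (hH : Hypercube.IsHyperplane H)
    (hdist : Metric.infDist (Hypercube.center d) (H : Set (EuclideanSpace ℝ (Fin d))) = t) :
    Hypercube.sectionVolume H ≤
        ENNReal.ofReal
          ((d : ℝ) ^ ((d : ℝ) / 2) / ((d - 1).factorial : ℝ) * (√(d : ℝ) / 2 - t) ^ (d - 1)) ∧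
      (Hypercube.sectionVolume H =
          ENNReal.ofReal
            ((d : ℝ) ^ ((d : ℝ) / 2) / ((d - 1).factorial : ℝ) * (√(d : ℝ) / 2 - t) ^ (d - 1)) ↔
        Hypercube.IsOrthogonalToDiagonal H) := by
  have ht0 : 0 < t := lt_of_le_of_lt (by positivity) ht₁
  obtain ⟨u, hu2, hHu⟩ := Hypercube.exists_normal ht0 hH hdist
  rw [Hypercube.isOrthogonalToDiagonal_iff hH.1 hu2 hHu]
  obtain ⟨n, rfl⟩ : ∃ n, d = n + 1 := ⟨d - 1, by omega⟩
  have hmain := Hypercube.section_bound_of_nonneg (n := n) (by omega) (fun i => |u i|)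
    (fun i => abs_nonneg _) (by simpa only [sq_abs] using hu2) ht₁ ht₂
  have hR : ((n + 1 : ℕ) : ℝ) ^ (((n + 1 : ℕ) : ℝ) / 2) / ((n + 1 - 1).factorial : ℝ) *
      (√((n + 1 : ℕ) : ℝ) / 2 - t) ^ (n + 1 - 1) = √((n + 1 : ℕ) : ℝ) *
        ((√((n + 1 : ℕ) : ℝ) * (√((n + 1 : ℕ) : ℝ) / 2 - t)) ^ n / n.factorial) := by
    have hpow : ((n + 1 : ℕ) : ℝ) ^ (((n + 1 : ℕ) : ℝ) / 2) = √((n + 1 : ℕ) : ℝ) ^ (n + 1) := by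
      rw [Real.sqrt_eq_rpow, ← Real.rpow_natCast, ← Real.rpow_mul (by positivity)]
      congr 1
      ring
    rw [hpow, Nat.add_sub_cancel, mul_pow, pow_succ]
    ring
  rw [hR, Hypercube.sectionVolume, hHu, Nat.add_sub_cancel, Hypercube.sectionVolume_abs]
  exact hmain
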